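/- For $\mu_1,\mu_2\in\mathbb{R}^d$ and symmetric positive definite $\Sigma_1,\Sigma_2\in\mathbb{R}^{d\times d}$, let $$\mathbb{D}\big((\mu_1,\Sigma_1)\,\|\,(\mu_2,\Sigma_2)\big)=(\mu_2-\mu_1)^\top\Sigma_2^{-1}(\mu_2-\mu_1)+\mathrm{Tr}(\Sigma_1\Sigma_2^{-1})-\log\det(\Sigma_1\Sigma_2^{-1})-d .$$ Theorem. Let $\xi$ be a $d$-dimensional random vector with finite fourth moment, mean vector $m\in\mathbb{R}^d$ and positive definite covariance matrix $S$ under a probability measure $\mathbb{P}$. Let $\hat\xi_1,\hat\xi_2,\dots$ be independent and identically distributed samples of $\xi$, and let $$\hat\mu_n=\frac1n\sum_{t=1}^n\hat\xi_t,\qquad \hat\Sigma_n=\frac1n\sum_{t=1}^n(\hat\xi_t-\hat\mu_n)(\hat\xi_t-\hat\mu_n)^\top .$$ Put $\eta=S^{-1/2}(\xi-m)$. There exist a random vector $H\in\mathbb{R}^d$ and a random symmetric matrix $Z\in\mathbb{R}^{d\times d}$ which are jointly Gaussian with mean zero and have the covariances $$\mathrm{cov}(H_i,H_{i'})=(I_d)_{ii'},\qquad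 \mathrm{cov}(Z_{jk},Z_{j'k'})=\mathbb{E}_{\mathbb P}[\eta_j\eta_k\eta_{j'}\eta_{k'}]-\mathbb{E}_{\mathbb P}[\eta_j\eta_k]\,\mathbb{E}_{\mathbb P}[\eta_{j'}\eta_{k'}],\qquad \mathrm{cov}(H_i,Z_{jk})=\mathbb{E}_{\mathbb P}[\eta_i\eta_j\eta_k].$$ The probability that $\hat\Sigma_n$ is positive definite tends to $1$ as $n\to\infty$, and for every such pair $(H,Z)$ $$n\cdot\mathbb{D}\big((\hat\mu_n,\hat\Sigma_n)\,\|\,(m,S)\big)\longrightarrow H^\top H+\tfrac12\mathrm{Tr}(Z^2)\quad\text{in distribution as } n\to\infty .$$ Here, on the event that $\hat\Sigma_n$ is singular, $\mathbb{D}$ is given by the same formula with $\log 0:=0$; since the probability of this event tends to zero, the choice of the value there does not matter. -/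

import Mathlib

open MeasureTheory ProbabilityTheory Filter Topology
open scoped Matrix

/-- The moment-based divergence
`D((μ₁, S₁) ‖ (μ₂, S₂)) = (μ₂ - μ₁)ᵀ S₂⁻¹ (μ₂ - μ₁) + Tr (S₁ S₂⁻¹) - log det (S₁ S₂⁻¹) - d`.
It is meant for positive definite `S₁` and `S₂`. -/
noncomputable def momentDivergence {d : ℕ} (μ₁ : Fin d → ℝ) (S₁ : Matrix (Fin d) (Fin d) ℝ)
    (μ₂ : Fin d → ℝ) (S₂ : Matrix (Fin d) (Fin d) ℝ) : ℝ :=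
  (μ₂ - μ₁) ⬝ᵥ (S₂⁻¹ *ᵥ (μ₂ - μ₁)) + (S₁ * S₂⁻¹).trace - Real.log (S₁ * S₂⁻¹).det - d

/-- The sample mean `(1/n) ∑ₜ xₜ` of the first `n` terms of a sequence of vectors. -/
noncomputable def sampleMean {d : ℕ} (n : ℕ) (x : ℕ → Fin d → ℝ) : Fin d → ℝ :=
  (1 / (n : ℝ)) • ∑ t ∈ Finset.range n, x t

/-- The sample covariance matrix `(1/n) ∑ₜ (xₜ - μ̂ₙ)(xₜ - μ̂ₙ)ᵀ` of the first `n` terms of a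
sequence of vectors, where `μ̂ₙ` is their sample mean. -/
noncomputable def sampleCov {d : ℕ} (n : ℕ) (x : ℕ → Fin d → ℝ) : Matrix (Fin d) (Fin d) ℝ :=
  (1 / (n : ℝ)) • ∑ t ∈ Finset.range n,
    Matrix.vecMulVec (x t - sampleMean n x) (x t - sampleMean n x)

open scoped MatrixOrder in
/-- The isotropic transformation `S^{-1/2} (x - m)` of a vector `x`, where `S^{1/2}` is the positive
semidefinite square root of `S`. -/
noncomputable def isotropic {d : ℕ} (m : Fin d → ℝ) (S : Matrix (Fin d) (Fin d) ℝ)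
    (x : Fin d → ℝ) : Fin d → ℝ :=
  (CFC.sqrt S)⁻¹ *ᵥ (x - m)

/-- `(H, Z)` is a random vector together with a random symmetric matrix (both on `(Ω', Q)`) which
are centered and jointly Gaussian, with the covariances given by the second, third and fourth
moments of the random vector `η` (on `(Ω, P)`). -/
structure IsGaussianLimitPair {d : ℕ} {Ω Ω' : Type*} [MeasurableSpace Ω] [MeasurableSpace Ω']
    (η : Ω → Fin d → ℝ) (P : Measure Ω)
    (H : Ω' → Fin d → ℝ) (Z : Ω' → Matrix (Fin d) (Fin d) ℝ) (Q : Measure Ω') : Prop where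
  symm : ∀ᵐ ω ∂Q, (Z ω).IsSymm
  gaussian : HasGaussianLaw (fun ω ↦ (H ω, fun p : Fin d × Fin d ↦ Z ω p.1 p.2)) Q
  mean_H : ∀ i, ∫ ω, H ω i ∂Q = 0
  mean_Z : ∀ j k, ∫ ω, Z ω j k ∂Q = 0
  cov_H : ∀ i i', cov[fun ω ↦ H ω i, fun ω ↦ H ω i'; Q] = (1 : Matrix (Fin d) (Fin d) ℝ) i i'
  cov_Z : ∀ j k j' k', cov[fun ω ↦ Z ω j k, fun ω ↦ Z ω j' k'; Q] =
    (∫ ω, η ω j * η ω k * η ω j' * η ω k' ∂P)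
      - (∫ ω, η ω j * η ω k ∂P) * (∫ ω, η ω j' * η ω k' ∂P)
  cov_HZ : ∀ i j k, cov[fun ω ↦ H ω i, fun ω ↦ Z ω j k; Q] = ∫ ω, η ω i * η ω j * η ω k ∂P

/-! The divergence is affine invariant, so `S^{-1/2}` reduces everything to the isotropic sample
`η_t`: it equals `|η̄|² + tr B - log det (1 + B)` with `B = sampleCov - 1`
(`momentDivergence_sample_eq`).

Let `u = (h, W)` be `n^{-1/2}` times the sum of the vectors `(η_t, η_t η_tᵀ - 1)`. Then `η̄ =
n^{-1/2} h` and `B = n^{-1/2} A` with `A = W - n^{-1/2} h hᵀ`. Since `tr B - log det (1 + B) =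
tr(B²)/2 + tr(B²) r(B)` with `r(B) → 0` as `B → 0`, multiplication by `n` gives exactly `hᵀh +
tr(A²)/2 + tr(A²) r(B)` (`mul_momentDivergence_sample_eq`).

The central limit theorem sends `u` to `(H, Z)` in law, the strong law gives `B → 0` almost surely,
and Slutsky's theorem with continuous mapping yields the limit. Positive definiteness follows from
the same strong law: `tr(B²) < 1` keeps the eigenvalues of `B` above `-1`. -/

/-! ### Second order expansion of `log det` at the identity. -/

lemma abs_sub_log_one_add_sub_half_sq_le {x : ℝ} (hx : |x| ≤ 1 / 2) :
    |x - Real.log (1 + x) - x ^ 2 / 2| ≤ 2 * |x| * x ^ 2 := by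
  have h := Real.abs_log_sub_add_sum_range_le (x := -x) (by rw [abs_neg]; linarith) 2
  -- The constant 2 comes from `1 - |x| ≥ 1/2` in the Taylor remainder.
  have hle : |x| ^ 3 / (1 - |x|) ≤ 2 * |x| * x ^ 2 := by
    rw [div_le_iff₀ (by linarith), ← sq_abs x]
    have : 0 ≤ |x| ^ 3 := by positivity
    nlinarith
  refine (le_of_eq ?_).trans (h.trans ((le_of_eq ?_).trans hle))
  · rw [← abs_neg]
    congr 1
    simp [Finset.sum_range_succ]
    ring
  · rw [abs_neg]

namespace Matrix.IsHermitian

variable {n : Type*} [Fintype n] [DecidableEq n] {B : Matrix n n ℝ}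

lemma exists_orthogonal_diagonalization (hB : B.IsHermitian) :
    ∃ U : Matrix n n ℝ, U * Uᵀ = 1 ∧ Uᵀ * U = 1 ∧
      B = U * diagonal hB.eigenvalues * Uᵀ := by
  refine ⟨hB.eigenvectorUnitary, ?_, ?_, ?_⟩
  · simpa [star_eq_conjTranspose] using Unitary.coe_mul_star_self hB.eigenvectorUnitary
  · simpa [star_eq_conjTranspose] using Unitary.coe_star_mul_self hB.eigenvectorUnitary
  · simpa [Unitary.conjStarAlgAut_apply, star_eq_conjTranspose, Function.comp_def] using
      hB.spectral_theorem

lemma trace_mul_self_eq_sum_sq_eigenvalues (hB : B.IsHermitian) :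
    (B * B).trace = ∑ i, hB.eigenvalues i ^ 2 := by
  obtain ⟨U, -, hU, h⟩ := hB.exists_orthogonal_diagonalization
  set D := diagonal hB.eigenvalues with hD
  have : B * B = U * (D * D) * Uᵀ := by
    rw [h]
    simp only [Matrix.mul_assoc]
    rw [← Matrix.mul_assoc Uᵀ U, hU, Matrix.one_mul]
  rw [this, Matrix.trace_mul_comm, ← Matrix.mul_assoc, hU, Matrix.one_mul, hD,
    Matrix.diagonal_mul_diagonal, Matrix.trace_diagonal]
  simp [sq]

lemma det_one_add_eq_prod (hB : B.IsHermitian) :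
    (1 + B).det = ∏ i, (1 + hB.eigenvalues i) := by
  obtain ⟨U, hU', hU, h⟩ := hB.exists_orthogonal_diagonalization
  have : 1 + B = U * (diagonal fun i ↦ 1 + hB.eigenvalues i) * Uᵀ := by
    have hd : (diagonal fun i ↦ 1 + hB.eigenvalues i) = 1 + diagonal hB.eigenvalues := by
      rw [← Matrix.diagonal_one, Matrix.diagonal_add]
    rw [hd, Matrix.mul_add, Matrix.add_mul, ← h, Matrix.mul_one, hU']
  rw [this, Matrix.det_mul_comm, ← Matrix.mul_assoc, hU, Matrix.one_mul, Matrix.det_diagonal]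

/-- `tr(B²)` is the sum of the squared eigenvalues, so this one polynomial in the entries controls
the whole spectrum; it measures the size of `B` throughout. -/
lemma abs_eigenvalues_le (hB : B.IsHermitian) (i : n) :
    |hB.eigenvalues i| ≤ √(B * B).trace := by
  rw [hB.trace_mul_self_eq_sum_sq_eigenvalues]
  exact Real.abs_le_sqrt
    (Finset.single_le_sum (f := fun i ↦ hB.eigenvalues i ^ 2) (fun _ _ ↦ sq_nonneg _)
      (Finset.mem_univ i))

lemma posDef_one_add (hB : B.IsHermitian) (h : (B * B).trace < 1) : (1 + B).PosDef := by
  have hB1 : (1 + B).IsHermitian := Matrix.isHermitian_one.add hB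
  obtain ⟨U, hU', hU, hBU⟩ := hB.exists_orthogonal_diagonalization
  have hd : (diagonal fun i ↦ 1 + hB.eigenvalues i) = 1 + diagonal hB.eigenvalues := by
    rw [← Matrix.diagonal_one, Matrix.diagonal_add]
  have h1 : 1 + B = U * (diagonal fun i ↦ 1 + hB.eigenvalues i) * Uᴴ := by
    rw [Matrix.conjTranspose_eq_transpose_of_trivial, hd, Matrix.mul_add, Matrix.add_mul, ← hBU,
      Matrix.mul_one, hU']
  rw [h1]
  refine Matrix.PosDef.mul_mul_conjTranspose_same (Matrix.PosDef.diagonal fun i ↦ ?_) ?_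
  · have := (abs_le.1 (hB.abs_eigenvalues_le i)).1
    have : √(B * B).trace < 1 := by rwa [Real.sqrt_lt' one_pos, one_pow]
    linarith
  · intro v w hvw
    simpa [Matrix.vecMul_vecMul, hU'] using congr(($hvw) ᵥ* Uᵀ)

/-- Second order expansion of `log det` at the identity. -/
lemma abs_trace_sub_log_det_one_add_sub_le (hB : B.IsHermitian) (h : (B * B).trace ≤ 1 / 4) :
    |B.trace - Real.log (1 + B).det - (B * B).trace / 2|
      ≤ 2 * √(B * B).trace * (B * B).trace := by
  -- The threshold `1/4` puts every eigenvalue in the range `|x| ≤ 1/2` of the scalar estimate.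
  have hsq : √(B * B).trace ≤ 1 / 2 := by
    rw [Real.sqrt_le_left (by norm_num)]
    norm_num
    linarith
  have hev i := (hB.abs_eigenvalues_le i).trans hsq
  have hlog : Real.log (1 + B).det = ∑ i, Real.log (1 + hB.eigenvalues i) := by
    rw [hB.det_one_add_eq_prod, Real.log_prod]
    intro i _
    have := (abs_le.1 (hev i)).1
    linarith
  have htr : B.trace = ∑ i, hB.eigenvalues i := by simpa using hB.trace_eq_sum_eigenvalues
  calc |B.trace - Real.log (1 + B).det - (B * B).trace / 2|
      = |∑ i, (hB.eigenvalues i - Real.log (1 + hB.eigenvalues i)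
          - hB.eigenvalues i ^ 2 / 2)| := by
        rw [hlog, htr, hB.trace_mul_self_eq_sum_sq_eigenvalues]
        simp [Finset.sum_sub_distrib, Finset.sum_div]
    _ ≤ ∑ i, 2 * |hB.eigenvalues i| * hB.eigenvalues i ^ 2 :=
        (Finset.abs_sum_le_sum_abs _ _).trans
          (Finset.sum_le_sum fun i _ ↦ abs_sub_log_one_add_sub_half_sq_le (hev i))
    _ ≤ ∑ i, 2 * √(B * B).trace * hB.eigenvalues i ^ 2 := by
        gcongr with i
        exact hB.abs_eigenvalues_le i
    _ = _ := by rw [← Finset.mul_sum, ← hB.trace_mul_self_eq_sum_sq_eigenvalues]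

lemma trace_mul_self_nonneg (hB : B.IsHermitian) : 0 ≤ (B * B).trace := by
  rw [hB.trace_mul_self_eq_sum_sq_eigenvalues]
  positivity

end Matrix.IsHermitian

/-! ### Covariance matrices and Gaussian vectors realizing them. -/

section Covariance

variable {Ω ι : Type*} [MeasurableSpace Ω] [Fintype ι] {μ : Measure Ω} [IsProbabilityMeasure μ]

lemma variance_fun_sum_const_mul {X : ι → Ω → ℝ} (hX : ∀ i, MemLp (X i) 2 μ) (c : ι → ℝ) :
    Var[fun ω ↦ ∑ i, c i * X i ω; μ] = ∑ i, ∑ j, c i * c j * cov[X i, X j; μ] := by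
  have hc i : MemLp (fun ω ↦ c i * X i ω) 2 μ := (hX i).const_mul _
  rw [← covariance_self (memLp_finsetSum _ fun i _ ↦ hc i).aemeasurable,
    covariance_fun_sum_fun_sum hc hc]
  simp_rw [covariance_const_mul_left, covariance_const_mul_right, mul_assoc]

/-- The quadratic form at `x` is the variance of `∑ x i * X i`. -/
lemma posSemidef_covariance {X : ι → Ω → ℝ} (hX : ∀ i, MemLp (X i) 2 μ) :
    (Matrix.of fun i j ↦ cov[X i, X j; μ]).PosSemidef := by
  refine Matrix.PosSemidef.of_dotProduct_mulVec_nonneg ?_ fun x ↦ ?_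
  · ext i j
    simp [covariance_comm (X i)]
  · have h := variance_nonneg (fun ω ↦ ∑ i, x i * X i ω) μ
    rw [variance_fun_sum_const_mul hX] at h
    refine h.trans_eq ?_
    simp [dotProduct, Matrix.mulVec, Finset.mul_sum, mul_assoc, mul_comm (x _) (cov[_, _; _])]

/-- Existence of a centered Gaussian vector with the same covariances as a square integrable
vector. -/
lemma exists_hasGaussianLaw_covariance_eq [DecidableEq ι] {X : ι → Ω → ℝ}
    (hX : ∀ i, MemLp (X i) 2 μ) :
    ∃ Q : Measure (EuclideanSpace ℝ ι), IsProbabilityMeasure Q ∧ HasGaussianLaw id Q ∧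
      (∀ i, ∫ x, x i ∂Q = 0) ∧ ∀ i j, cov[fun x ↦ x i, fun x ↦ x j; Q] = cov[X i, X j; μ] := by
  refine ⟨multivariateGaussian 0 (Matrix.of fun i j ↦ cov[X i, X j; μ]), inferInstance,
    IsGaussian.hasGaussianLaw_id, fun i ↦ ?_, fun i j ↦ ?_⟩
  · have h := (EuclideanSpace.proj i : EuclideanSpace ℝ ι →L[ℝ] ℝ).integral_comp_id_comm
      (μ := multivariateGaussian 0 (Matrix.of fun i j ↦ cov[X i, X j; μ])) IsGaussian.integrable_id
    simpa using h
  · simpa using covariance_eval_multivariateGaussian (posSemidef_covariance hX) i j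

end Covariance

/-! ### Multivariate central limit theorem. -/

section CentralLimit

variable {Ω Ω' ι : Type*} [MeasurableSpace Ω] [MeasurableSpace Ω'] [Fintype ι]
  {P : Measure Ω} {Q : Measure Ω'}

open scoped RealInnerProductSpace in
lemma charFun_map_eq_charFun_map_inner {E : Type*} [NormedAddCommGroup E] [InnerProductSpace ℝ E]
    [MeasurableSpace E] [BorelSpace E] [SecondCountableTopology E] {X : Ω → E}
    (hX : AEMeasurable X P) (t : E) :
    charFun (P.map X) t = charFun (P.map fun ω ↦ ⟪X ω, t⟫) 1 := by
  rw [charFun_apply, charFun_apply, integral_map hX (by fun_prop), integral_map (by fun_prop)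
    (by fun_prop)]
  simp

variable [IsProbabilityMeasure P] [IsProbabilityMeasure Q]

open scoped RealInnerProductSpace in
/-- The Cramér-Wold device. -/
lemma tendstoInDistribution_of_inner {E : Type*} [NormedAddCommGroup E] [InnerProductSpace ℝ E]
    [FiniteDimensional ℝ E] [MeasurableSpace E] [BorelSpace E] {X : ℕ → Ω → E} {Y : Ω' → E}
    (hX : ∀ n, AEMeasurable (X n) P) (hY : AEMeasurable Y Q)
    (h : ∀ t : E, TendstoInDistribution (fun n ω ↦ ⟪X n ω, t⟫) atTop (fun ω ↦ ⟪Y ω, t⟫)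
      (fun _ ↦ P) Q) :
    TendstoInDistribution X atTop Y (fun _ ↦ P) Q where
  forall_aemeasurable := hX
  aemeasurable_limit := hY
  tendsto := by
    -- Lévy's continuity theorem: the characteristic function at `t` is that of the projection on
    -- `t` at frequency 1.
    refine ProbabilityMeasure.tendsto_iff_tendsto_charFun.2 fun t ↦ ?_
    have := ProbabilityMeasure.tendsto_iff_tendsto_charFun.1 (h t).tendsto 1
    simp only [ProbabilityMeasure.coe_mk] at this ⊢
    simp_rw [charFun_map_eq_charFun_map_inner (hX _), charFun_map_eq_charFun_map_inner hY]
    exact this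

/-- **Multivariate central limit theorem** for centered vectors. -/
theorem tendstoInDistribution_inv_sqrt_smul_sum {V : ℕ → Ω → ι → ℝ} {Y : Ω' → ι → ℝ}
    (hindep : iIndepFun V P) (hident : ∀ k, IdentDistrib (V k) (V 0) P P)
    (hV : ∀ i, MemLp (fun ω ↦ V 0 ω i) 2 P) (hV0 : ∀ i, ∫ ω, V 0 ω i ∂P = 0)
    (hY : HasGaussianLaw Y Q) (hY0 : ∀ i, ∫ ω, Y ω i ∂Q = 0)
    (hcov : ∀ i j, cov[fun ω ↦ Y ω i, fun ω ↦ Y ω j; Q] =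
      cov[fun ω ↦ V 0 ω i, fun ω ↦ V 0 ω j; P]) :
    TendstoInDistribution (fun (n : ℕ) ω ↦ (√n)⁻¹ • ∑ k ∈ Finset.range n, V k ω) atTop Y
      (fun _ ↦ P) Q := by
  have mV k : AEMeasurable (V k) P := (hident k).aemeasurable_fst
  have hYi i : HasGaussianLaw (fun ω ↦ Y ω i) Q := hY.eval i
  -- The sup-normed `ι → ℝ` has no inner product, so the argument runs in `EuclideanSpace`.
  suffices TendstoInDistribution
      (fun (n : ℕ) ω ↦ WithLp.toLp 2 ((√n)⁻¹ • ∑ k ∈ Finset.range n, V k ω)) atTop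
      (fun ω ↦ WithLp.toLp 2 (Y ω)) (fun _ ↦ P) Q from
    this.continuous_comp (g := fun x : EuclideanSpace ℝ ι ↦ WithLp.ofLp x) (by fun_prop)
  refine tendstoInDistribution_of_inner (fun n ↦ ?_) (by fun_prop) fun t ↦ ?_
  · have : AEMeasurable (fun ω ↦ (√n)⁻¹ • ∑ k ∈ Finset.range n, V k ω) P :=
      AEMeasurable.fun_const_smul (Finset.aemeasurable_fun_sum _ fun k _ ↦ mV k) _
    exact (WithLp.measurable_toLp 2 _).comp_aemeasurable this
  -- Projection on `t`. The real central limit theorem applies to `f (V k)`; its limit is the law of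
  -- `f (Y)`, a real Gaussian being determined by its mean and variance.
  let f : (ι → ℝ) → ℝ := fun v ↦ ∑ i, t i * v i
  have hf : Measurable f := by fun_prop
  have hfL : MemLp (fun ω ↦ f (V 0 ω)) 2 P := memLp_finsetSum _ fun i _ ↦ (hV i).const_mul _
  have hf0 : ∫ ω, f (V 0 ω) ∂P = 0 := by
    rw [integral_finsetSum _ fun i _ ↦ ((hV i).integrable (by norm_num)).const_mul _]
    simp [integral_const_mul, hV0]
  have hvar : Var[fun ω ↦ f (Y ω); Q] = Var[fun ω ↦ f (V 0 ω); P] := by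
    rw [variance_fun_sum_const_mul (fun i ↦ (hYi i).memLp_two), variance_fun_sum_const_mul hV]
    simp_rw [hcov]
  have hYf : HasGaussianLaw (fun ω ↦ f (Y ω)) Q := by
    refine (hY.map_fun (∑ i, t i • ContinuousLinearMap.proj (R := ℝ) (φ := fun _ : ι ↦ ℝ) i)).congr
      (.of_forall fun ω ↦ ?_)
    simp [f]
  have hYf0 : ∫ ω, f (Y ω) ∂Q = 0 := by
    rw [integral_finsetSum _ fun i _ ↦ (hYi i).integrable.const_mul _]
    simp [integral_const_mul, hY0]
  have key := tendstoInDistribution_inv_sqrt_mul_sum_sub (X := fun k ω ↦ f (V k ω))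
    (P := P) (P' := Q) (Y := fun ω ↦ f (Y ω))
    ⟨hYf.aemeasurable, by rw [hYf.map_eq_gaussianReal, hYf0, hvar]⟩
    hfL (hindep.comp (fun _ ↦ f) fun _ ↦ hf) (fun k ↦ (hident k).comp hf)
  refine key.congr (fun n ↦ .of_forall fun ω ↦ ?_) (.of_forall fun ω ↦ ?_)
  · simp only [hf0, mul_zero, sub_zero, f, PiLp.inner_apply]
    simp only [Pi.smul_apply, Finset.sum_apply, smul_eq_mul, RCLike.inner_apply,
      conj_trivial]
    rw [Finset.sum_comm, Finset.mul_sum]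
    exact Finset.sum_congr rfl fun i _ ↦ by rw [← Finset.mul_sum]; ring
  · simp [f, PiLp.inner_apply]

end CentralLimit

/-! ### The square root of a positive definite matrix. -/

section SqrtMatrix

open scoped MatrixOrder

variable {n : Type*} [Fintype n] [DecidableEq n] {S : Matrix n n ℝ}

lemma Matrix.PosDef.sqrt_mul_sqrt_self (hS : S.PosDef) : CFC.sqrt S * CFC.sqrt S = S :=
  CFC.sqrt_mul_sqrt_self S hS.posSemidef.nonneg

lemma Matrix.transpose_cfcSqrt (S : Matrix n n ℝ) : (CFC.sqrt S)ᵀ = CFC.sqrt S := by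
  have h := (CFC.sqrt_nonneg S).isSelfAdjoint.star_eq
  rwa [Matrix.star_eq_conjTranspose, Matrix.conjTranspose_eq_transpose_of_trivial] at h

lemma Matrix.PosDef.isUnit_det_cfcSqrt (hS : S.PosDef) : IsUnit (CFC.sqrt S).det := by
  have h : (CFC.sqrt S).det * (CFC.sqrt S).det = S.det := by
    rw [← Matrix.det_mul, hS.sqrt_mul_sqrt_self]
  refine isUnit_iff_ne_zero.2 fun h0 ↦ hS.det_pos.ne' ?_
  rw [← h, h0, mul_zero]

lemma Matrix.PosDef.inv_sqrt_mul_mul_inv_sqrt (hS : S.PosDef) :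
    (CFC.sqrt S)⁻¹ * S * (CFC.sqrt S)⁻¹ = 1 := by
  have hu := hS.isUnit_det_cfcSqrt
  conv_lhs => enter [1, 2]; rw [← hS.sqrt_mul_sqrt_self]
  rw [← Matrix.mul_assoc, Matrix.nonsing_inv_mul _ hu, Matrix.one_mul, Matrix.mul_nonsing_inv _ hu]

end SqrtMatrix

/-! ### Reduction to the isotropic sample and to normalized sums. -/

section Sample

variable {d : ℕ}

lemma sampleMean_mulVec_sub {n : ℕ} (hn : n ≠ 0) (M : Matrix (Fin d) (Fin d) ℝ) (m : Fin d → ℝ)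
    (x : ℕ → Fin d → ℝ) :
    sampleMean n (fun t ↦ M *ᵥ (x t - m)) = M *ᵥ (sampleMean n x - m) := by
  have hn' : (n : ℝ) ≠ 0 := by exact_mod_cast hn
  simp only [sampleMean, ← Matrix.mulVec_sum, ← Matrix.mulVec_smul, Finset.sum_sub_distrib,
    smul_sub, Finset.sum_const, Finset.card_range]
  congr 2
  rw [← Nat.cast_smul_eq_nsmul ℝ, smul_smul, one_div_mul_cancel hn', one_smul]

lemma sampleCov_mulVec_sub {n : ℕ} (hn : n ≠ 0) (M : Matrix (Fin d) (Fin d) ℝ) (m : Fin d → ℝ)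
    (x : ℕ → Fin d → ℝ) :
    sampleCov n (fun t ↦ M *ᵥ (x t - m)) = M * sampleCov n x * Mᵀ := by
  have h t : M *ᵥ (x t - m) - M *ᵥ (sampleMean n x - m) = M *ᵥ (x t - sampleMean n x) := by
    rw [← Matrix.mulVec_sub, sub_sub_sub_cancel_right]
  simp only [sampleCov, sampleMean_mulVec_sub hn, h, Matrix.mul_smul, Matrix.smul_mul,
    Matrix.mul_sum, Matrix.sum_mul, Matrix.mul_vecMulVec, Matrix.vecMulVec_mul,
    Matrix.vecMul_transpose]

lemma sampleCov_apply {n : ℕ} (hn : n ≠ 0) (x : ℕ → Fin d → ℝ) (j k : Fin d) :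
    sampleCov n x j k = (1 / (n : ℝ)) * ∑ t ∈ Finset.range n, x t j * x t k
      - sampleMean n x j * sampleMean n x k := by
  have hn' : (n : ℝ) ≠ 0 := by exact_mod_cast hn
  have hsum i : ∑ t ∈ Finset.range n, x t i = n * sampleMean n x i := by
    simp [sampleMean, hn']
  simp only [sampleCov, Matrix.smul_apply, Matrix.sum_apply, Matrix.vecMulVec_apply, Pi.sub_apply,
    smul_eq_mul, sub_mul, mul_sub, Finset.sum_sub_distrib, ← Finset.sum_mul, ← Finset.mul_sum, hsum,
    Finset.sum_const, Finset.card_range, nsmul_eq_mul]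
  field_simp
  ring

open scoped MatrixOrder in
/-- The divergence in terms of the isotropic transformation of the sample. -/
lemma momentDivergence_sample_eq {n : ℕ} (hn : n ≠ 0) {m : Fin d → ℝ}
    {S : Matrix (Fin d) (Fin d) ℝ} (hS : S.PosDef) (x : ℕ → Fin d → ℝ) :
    momentDivergence (sampleMean n x) (sampleCov n x) m S =
      sampleMean n (fun t ↦ isotropic m S (x t)) ⬝ᵥ sampleMean n (fun t ↦ isotropic m S (x t))
      + ((sampleCov n (fun t ↦ isotropic m S (x t)) - 1).trace
        - Real.log (sampleCov n (fun t ↦ isotropic m S (x t))).det) := by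
  have hR : ((CFC.sqrt S)⁻¹)ᵀ = (CFC.sqrt S)⁻¹ := by
    rw [Matrix.transpose_nonsing_inv, Matrix.transpose_cfcSqrt]
  have hSinv : S⁻¹ = (CFC.sqrt S)⁻¹ * (CFC.sqrt S)⁻¹ := by
    rw [← Matrix.mul_inv_rev, hS.sqrt_mul_sqrt_self]
  simp only [isotropic, sampleMean_mulVec_sub hn, sampleCov_mulVec_sub hn, hR]
  -- Trace and determinant are cyclic, so one factor `S^{-1/2}` can be moved to the left of the
  -- sample covariance.
  have htr : (sampleCov n x * ((CFC.sqrt S)⁻¹ * (CFC.sqrt S)⁻¹)).trace =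
      ((CFC.sqrt S)⁻¹ * sampleCov n x * (CFC.sqrt S)⁻¹).trace := by
    rw [← Matrix.mul_assoc, Matrix.trace_mul_comm, ← Matrix.mul_assoc]
  have hdet : (sampleCov n x * ((CFC.sqrt S)⁻¹ * (CFC.sqrt S)⁻¹)).det =
      ((CFC.sqrt S)⁻¹ * sampleCov n x * (CFC.sqrt S)⁻¹).det := by
    rw [← Matrix.mul_assoc, Matrix.det_mul_comm, ← Matrix.mul_assoc]
  rw [momentDivergence, hSinv, htr, hdet, Matrix.trace_sub, Matrix.trace_one, Fintype.card_fin,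
    ← Matrix.mulVec_mulVec]
  have hq : (m - sampleMean n x) ⬝ᵥ ((CFC.sqrt S)⁻¹ *ᵥ (CFC.sqrt S)⁻¹ *ᵥ (m - sampleMean n x)) =
      ((CFC.sqrt S)⁻¹ *ᵥ (sampleMean n x - m)) ⬝ᵥ ((CFC.sqrt S)⁻¹ *ᵥ (sampleMean n x - m)) := by
    rw [← neg_sub (sampleMean n x), Matrix.mulVec_neg, Matrix.mulVec_neg, neg_dotProduct_neg,
      Matrix.dotProduct_mulVec, ← Matrix.mulVec_transpose, hR]
  rw [hq]
  ring

open scoped MatrixOrder in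
/-- The sample covariance matrix is positive definite if that of the isotropic sample is. -/
lemma posDef_sampleCov_of_isotropic {n : ℕ} (hn : n ≠ 0) {m : Fin d → ℝ}
    {S : Matrix (Fin d) (Fin d) ℝ} (hS : S.PosDef) {x : ℕ → Fin d → ℝ}
    (h : (sampleCov n fun t ↦ isotropic m S (x t)).PosDef) : (sampleCov n x).PosDef := by
  simp only [isotropic, sampleCov_mulVec_sub hn] at h
  have hu : IsUnit (CFC.sqrt S)⁻¹ :=
    (Matrix.isUnit_nonsing_inv_iff).2 ((Matrix.isUnit_iff_isUnit_det _).2 hS.isUnit_det_cfcSqrt)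
  rw [← Matrix.conjTranspose_eq_transpose_of_trivial] at h
  exact (Matrix.IsUnit.posDef_star_right_conjugate_iff hu).1 h

/-- The vector of first and centered second order monomials of an isotropic vector. -/
def momentVector (y : Fin d → ℝ) : Fin d ⊕ Fin d × Fin d → ℝ :=
  Sum.elim y fun p ↦ y p.1 * y p.2 - (1 : Matrix (Fin d) (Fin d) ℝ) p.1 p.2

/-- The matrix `W - ε h hᵀ` for a vector `u = (h, W)`. -/
def correctedMatrix (ε : ℝ) (u : Fin d ⊕ Fin d × Fin d → ℝ) : Matrix (Fin d) (Fin d) ℝ :=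
  Matrix.of fun j k ↦ u (.inr (j, k)) - ε * (u (.inl j) * u (.inl k))

lemma sampleMean_eq_smul (n : ℕ) (y : ℕ → Fin d → ℝ) (i : Fin d) :
    sampleMean n y i =
      (√n)⁻¹ * ((√n)⁻¹ • ∑ t ∈ Finset.range n, momentVector (y t)) (.inl i) := by
  simp only [sampleMean, Pi.smul_apply, Finset.sum_apply, smul_eq_mul, momentVector, Sum.elim_inl]
  rw [← mul_assoc, ← mul_inv, Real.mul_self_sqrt n.cast_nonneg, one_div]

/-- The sample mean is `n^{-1/2} h`, so subtracting its outer product costs `n^{-1} h hᵀ`, one order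
below the leading term `n^{-1/2} W`. -/
lemma sampleCov_sub_one_eq_smul {n : ℕ} (hn : n ≠ 0) (y : ℕ → Fin d → ℝ) :
    sampleCov n y - 1 = (√n)⁻¹ • correctedMatrix (√n)⁻¹
      ((√n)⁻¹ • ∑ t ∈ Finset.range n, momentVector (y t)) := by
  have hn' : (n : ℝ) ≠ 0 := by exact_mod_cast hn
  ext j k
  rw [Matrix.sub_apply, sampleCov_apply hn, sampleMean_eq_smul, sampleMean_eq_smul]
  simp only [correctedMatrix, Matrix.smul_apply, Matrix.of_apply, smul_eq_mul]
  set u := (√n)⁻¹ • ∑ t ∈ Finset.range n, momentVector (y t) with hu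
  have : u (.inr (j, k)) = (√n)⁻¹ * (∑ t ∈ Finset.range n, y t j * y t k
      - n * (1 : Matrix (Fin d) (Fin d) ℝ) j k) := by
    simp [hu, momentVector, Finset.sum_apply, Finset.sum_sub_distrib]
  rw [this, mul_sub, ← mul_assoc (√n)⁻¹ (√n)⁻¹, ← mul_inv, Real.mul_self_sqrt n.cast_nonneg]
  have h2 : (√(n : ℝ))⁻¹ * (√(n : ℝ))⁻¹ = (n : ℝ)⁻¹ := by
    rw [← mul_inv, Real.mul_self_sqrt n.cast_nonneg]
  have h3 : (n : ℝ)⁻¹ * n = 1 := inv_mul_cancel₀ hn'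
  linear_combination ((1 : Matrix (Fin d) (Fin d) ℝ) j k) * h3

/-- The relative error of the second order expansion of `log det` at the identity. -/
noncomputable def logDetError (B : Matrix (Fin d) (Fin d) ℝ) : ℝ :=
  (B.trace - Real.log (1 + B).det - (B * B).trace / 2) / (B * B).trace

end Sample

/-! ### The relative error of the expansion: smallness and measurability. -/

section LogDet

variable {d : ℕ}

/-- An exact identity without any smallness condition; it also covers singular `1 + B`, where
`Real.log 0 = 0`. -/
lemma trace_sub_log_det_one_add_eq {B : Matrix (Fin d) (Fin d) ℝ} (hB : B.IsHermitian) :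
    B.trace - Real.log (1 + B).det = (B * B).trace / 2 + (B * B).trace * logDetError B := by
  by_cases h : (B * B).trace = 0
  -- Here `logDetError B` divides by zero, but the error bound is zero too and forces equality.
  · have := hB.abs_trace_sub_log_det_one_add_sub_le (by rw [h]; norm_num)
    simp only [h, mul_zero, abs_nonpos_iff] at this
    rw [h]
    linarith
  · rw [logDetError]
    field_simp
    ring

lemma abs_logDetError_le {B : Matrix (Fin d) (Fin d) ℝ} (hB : B.IsHermitian)
    (h : (B * B).trace ≤ 1 / 4) : |logDetError B| ≤ 2 * √(B * B).trace := by
  have h0 := hB.trace_mul_self_nonneg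
  rw [logDetError, abs_div, abs_of_nonneg h0]
  exact div_le_of_le_mul₀ h0 (by positivity) (hB.abs_trace_sub_log_det_one_add_sub_le h)

lemma tendsto_logDetError {α : Type*} {l : Filter α} {B : α → Matrix (Fin d) (Fin d) ℝ}
    (hB : ∀ a, (B a).IsHermitian) (h : Tendsto (fun a ↦ (B a * B a).trace) l (𝓝 0)) :
    Tendsto (fun a ↦ logDetError (B a)) l (𝓝 0) := by
  have h2 : Tendsto (fun a ↦ 2 * √(B a * B a).trace) l (𝓝 0) := by
    simpa using (h.sqrt).const_mul 2
  refine squeeze_zero_norm' ?_ h2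
  filter_upwards [h.eventually_le_const (show (0 : ℝ) < 1 / 4 by norm_num)] with a ha
  exact abs_logDetError_le (hB a) ha

lemma continuous_correctedMatrix :
    Continuous fun p : ℝ × (Fin d ⊕ Fin d × Fin d → ℝ) ↦ correctedMatrix p.1 p.2 := by
  refine continuous_matrix fun j k ↦ ?_
  simp only [correctedMatrix, Matrix.of_apply]
  fun_prop

lemma measurable_momentVector : Measurable (momentVector (d := d)) := by
  refine measurable_pi_iff.2 fun a ↦ ?_
  rcases a with i | p <;> simp only [momentVector, Sum.elim_inl, Sum.elim_inr] <;> fun_prop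

lemma measurable_isotropic (m : Fin d → ℝ) (S : Matrix (Fin d) (Fin d) ℝ) :
    Measurable (isotropic m S) := by
  refine Continuous.measurable ?_
  unfold isotropic
  fun_prop

lemma measurable_trace_mul_self_correctedMatrix (ε : ℝ) :
    Measurable fun u : Fin d ⊕ Fin d × Fin d → ℝ ↦
      ((ε • correctedMatrix ε u) * (ε • correctedMatrix ε u)).trace := by
  have h : Continuous fun u : Fin d ⊕ Fin d × Fin d → ℝ ↦ ε • correctedMatrix ε u :=
    (continuous_correctedMatrix.comp (by fun_prop : Continuous fun u ↦ (ε, u))).const_smul ε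
  exact (h.matrix_mul h).matrix_trace.measurable

/-- The error is not continuous in `u`, but measurability is all that Slutsky's theorem asks of the
factor converging in probability. -/
lemma measurable_logDetError_correctedMatrix (ε : ℝ) :
    Measurable fun u : Fin d ⊕ Fin d × Fin d → ℝ ↦ logDetError (ε • correctedMatrix ε u) := by
  have h : Continuous fun u : Fin d ⊕ Fin d × Fin d → ℝ ↦ ε • correctedMatrix ε u :=
    (continuous_correctedMatrix.comp (by fun_prop : Continuous fun u ↦ (ε, u))).const_smul ε
  have h1 := h.matrix_trace.measurable
  have h2 := (continuous_const (y := 1).add h).matrix_det.measurable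
  have h3 := measurable_trace_mul_self_correctedMatrix (d := d) ε
  exact ((h1.sub h2.log).sub (h3.div_const 2)).div h3

/-- Symmetry comes from `momentVector`; for arbitrary `u` the block `W` need not be symmetric. -/
lemma isHermitian_smul_correctedMatrix_sum (n : ℕ) (ε : ℝ) (y : ℕ → Fin d → ℝ) :
    (ε • correctedMatrix ε (ε • ∑ t ∈ Finset.range n, momentVector (y t))).IsHermitian := by
  ext j k
  simp [correctedMatrix, momentVector, Finset.sum_apply, mul_comm, Matrix.one_apply, eq_comm]

end LogDet

/-! ### Moments of the isotropic vector and the Gaussian limit pair. -/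

section Moments

variable {d : ℕ} {Ω : Type*} [MeasurableSpace Ω] {P : Measure Ω}

lemma MeasureTheory.MemLp.isotropic_apply [IsProbabilityMeasure P] {ξ : Ω → Fin d → ℝ}
    {p : ENNReal} (hξ : MemLp ξ p P) (m : Fin d → ℝ) (S : Matrix (Fin d) (Fin d) ℝ) (i : Fin d) :
    MemLp (fun ω ↦ isotropic m S (ξ ω) i) p P := by
  simp only [isotropic, Matrix.mulVec, dotProduct]
  exact memLp_finsetSum _ fun j _ ↦ ((hξ.eval j).sub (memLp_const (m j))).const_mul _

lemma integral_isotropic_apply [IsProbabilityMeasure P] {ξ : Ω → Fin d → ℝ} {m : Fin d → ℝ}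
    (S : Matrix (Fin d) (Fin d) ℝ) (hξ : MemLp ξ 2 P) (hm : ∀ i, ∫ ω, ξ ω i ∂P = m i)
    (i : Fin d) : ∫ ω, isotropic m S (ξ ω) i ∂P = 0 := by
  have hint j : Integrable (fun ω ↦ ξ ω j) P := (hξ.eval j).integrable (by norm_num)
  simp only [isotropic, Matrix.mulVec, dotProduct, Pi.sub_apply]
  have hint' j : Integrable (fun ω ↦ ξ ω j - m j) P := (hint j).sub (integrable_const _)
  rw [integral_finsetSum _ fun j _ ↦ (hint' j).const_mul _]
  refine Finset.sum_eq_zero fun j _ ↦ ?_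
  rw [integral_const_mul, integral_sub (hint j) (integrable_const _), hm]
  simp

lemma integral_isotropic_mul_isotropic [IsProbabilityMeasure P] {ξ : Ω → Fin d → ℝ}
    {m : Fin d → ℝ} {S : Matrix (Fin d) (Fin d) ℝ} (hξ : MemLp ξ 2 P)
    (hm : ∀ i, ∫ ω, ξ ω i ∂P = m i)
    (hcov : ∀ i j, cov[fun ω ↦ ξ ω i, fun ω ↦ ξ ω j; P] = S i j) (hS : S.PosDef) (i j : Fin d) :
    ∫ ω, isotropic m S (ξ ω) i * isotropic m S (ξ ω) j ∂P
      = (1 : Matrix (Fin d) (Fin d) ℝ) i j := by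
  have hL i := hξ.isotropic_apply m S i
  have hc a : MemLp (fun ω ↦ ξ ω a - m a) 2 P := (hξ.eval a).sub (memLp_const (m a))
  have h := covariance_eq_sub (hL i) (hL j)
  simp only [integral_isotropic_apply S hξ hm, mul_zero, sub_zero, Pi.mul_apply] at h
  rw [← h]
  simp only [isotropic, Matrix.mulVec, dotProduct, Pi.sub_apply]
  rw [covariance_fun_sum_fun_sum (fun a ↦ (hc a).const_mul _) (fun a ↦ (hc a).const_mul _)]
  have hint a : Integrable (fun ω ↦ ξ ω a) P := (hξ.eval a).integrable (by norm_num)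
  have hint' a : Integrable (fun ω ↦ ξ ω a - m a) P := (hc a).integrable (by norm_num)
  simp_rw [covariance_const_mul_left, covariance_const_mul_right,
    covariance_sub_const_left (hint _), covariance_sub_const_right (hint _), hcov]
  rw [← hS.inv_sqrt_mul_mul_inv_sqrt]
  conv_rhs => enter [2]; rw [← Matrix.transpose_cfcSqrt S, ← Matrix.transpose_nonsing_inv]
  simp only [Matrix.mul_apply, Finset.sum_mul, Matrix.transpose_apply]
  rw [Finset.sum_comm]
  exact Finset.sum_congr rfl fun a _ ↦ Finset.sum_congr rfl fun b _ ↦ by ring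

variable {η : Ω → Fin d → ℝ}

lemma memLp_two_mul_of_memLp_four (hη : ∀ i, MemLp (fun ω ↦ η ω i) 4 P) (j k : Fin d) :
    MemLp (fun ω ↦ η ω j * η ω k) 2 P := by
  have : ENNReal.HolderTriple 4 4 2 := ⟨by
    rw [← two_mul, show (4 : ENNReal) = 2 * 2 by norm_num,
      ENNReal.mul_inv (by simp) (by simp), ← mul_assoc, ENNReal.mul_inv_cancel (by simp) (by simp),
      one_mul]⟩
  exact (hη k).mul (hη j)

variable {Ω' : Type*} [MeasurableSpace Ω'] {Q : Measure Ω'} {H : Ω' → Fin d → ℝ}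
  {Z : Ω' → Matrix (Fin d) (Fin d) ℝ}

/-- Joins `H` and `Z` into one vector with the index type of `momentVector`, as the central limit
theorem requires. -/
lemma IsGaussianLimitPair.hasGaussianLaw_sumElim (hG : IsGaussianLimitPair η P H Z Q) :
    HasGaussianLaw (fun ω ↦ Sum.elim (H ω) (fun p : Fin d × Fin d ↦ Z ω p.1 p.2)) Q := by
  let F : ((Fin d → ℝ) × (Fin d × Fin d → ℝ)) →L[ℝ] (Fin d ⊕ Fin d × Fin d → ℝ) :=
    ContinuousLinearMap.pi (Sum.elim
      (fun i ↦ (ContinuousLinearMap.proj i).comp (ContinuousLinearMap.fst ℝ _ _))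
      (fun p ↦ (ContinuousLinearMap.proj p).comp (ContinuousLinearMap.snd ℝ _ _)))
  refine (hG.gaussian.map_fun F).congr (.of_forall fun ω ↦ ?_)
  ext a
  rcases a with i | p <;> simp [F]

variable [IsProbabilityMeasure P]

lemma covariance_mul_mul (hη : ∀ i, MemLp (fun ω ↦ η ω i) 4 P) (j k j' k' : Fin d) :
    cov[fun ω ↦ η ω j * η ω k, fun ω ↦ η ω j' * η ω k'; P] =
      (∫ ω, η ω j * η ω k * η ω j' * η ω k' ∂P)
        - (∫ ω, η ω j * η ω k ∂P) * (∫ ω, η ω j' * η ω k' ∂P) := by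
  rw [covariance_eq_sub (memLp_two_mul_of_memLp_four hη j k)
    (memLp_two_mul_of_memLp_four hη j' k')]
  simp only [Pi.mul_apply, mul_assoc]

lemma covariance_apply_mul (hη : ∀ i, MemLp (fun ω ↦ η ω i) 4 P)
    (hη0 : ∀ i, ∫ ω, η ω i ∂P = 0) (i j k : Fin d) :
    cov[fun ω ↦ η ω i, fun ω ↦ η ω j * η ω k; P] = ∫ ω, η ω i * η ω j * η ω k ∂P := by
  rw [covariance_eq_sub ((hη i).mono_exponent (by norm_num)) (memLp_two_mul_of_memLp_four hη j k),
    hη0]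
  simp only [Pi.mul_apply, mul_assoc, zero_mul, sub_zero]

lemma covariance_apply_apply (hη : ∀ i, MemLp (fun ω ↦ η ω i) 4 P)
    (hη0 : ∀ i, ∫ ω, η ω i ∂P = 0)
    (hη1 : ∀ i j, ∫ ω, η ω i * η ω j ∂P = (1 : Matrix (Fin d) (Fin d) ℝ) i j) (i j : Fin d) :
    cov[fun ω ↦ η ω i, fun ω ↦ η ω j; P] = (1 : Matrix (Fin d) (Fin d) ℝ) i j := by
  rw [covariance_eq_sub ((hη i).mono_exponent (by norm_num))
    ((hη j).mono_exponent (by norm_num)), hη0, zero_mul, sub_zero, ← hη1]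
  rfl

/-- The Gaussian limit pair exists; indexing the entries of `Z` by unordered pairs makes it
symmetric. -/
lemma exists_isGaussianLimitPair (hη : ∀ i, MemLp (fun ω ↦ η ω i) 4 P)
    (hη0 : ∀ i, ∫ ω, η ω i ∂P = 0)
    (hη1 : ∀ i j, ∫ ω, η ω i * η ω j ∂P = (1 : Matrix (Fin d) (Fin d) ℝ) i j) :
    ∃ (Ω' : Type) (_ : MeasurableSpace Ω') (Q : Measure Ω') (_ : IsProbabilityMeasure Q)
      (H : Ω' → Fin d → ℝ) (Z : Ω' → Matrix (Fin d) (Fin d) ℝ), IsGaussianLimitPair η P H Z Q := by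
  let X : Fin d ⊕ Sym2 (Fin d) → Ω → ℝ := Sum.elim (fun i ω ↦ η ω i)
    fun s ω ↦ Sym2.lift ⟨fun j k ↦ η ω j * η ω k, fun _ _ ↦ mul_comm _ _⟩ s
  have hX a : MemLp (X a) 2 P := by
    rcases a with i | s
    · exact (hη i).mono_exponent (by norm_num)
    · induction s using Sym2.ind with
      | _ j k => exact memLp_two_mul_of_memLp_four hη j k
  obtain ⟨Q, hQ, hG, hmean, hcov⟩ := exists_hasGaussianLaw_covariance_eq hX
  refine ⟨EuclideanSpace ℝ (Fin d ⊕ Sym2 (Fin d)), inferInstance, Q, hQ, fun ω i ↦ ω (.inl i),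
    fun ω ↦ Matrix.of fun j k ↦ ω (.inr s(j, k)), ?_, ?_, fun i ↦ hmean _, fun j k ↦ hmean _,
    fun i i' ↦ ?_, fun j k j' k' ↦ ?_, fun i j k ↦ ?_⟩
  · refine .of_forall fun ω ↦ ?_
    ext j k
    simp [Sym2.eq_swap (a := j)]
  · let pr (a : Fin d ⊕ Sym2 (Fin d)) : EuclideanSpace ℝ (Fin d ⊕ Sym2 (Fin d)) →L[ℝ] ℝ :=
      EuclideanSpace.proj a
    exact hG.map_fun ((ContinuousLinearMap.pi fun i ↦ pr (.inl i)).prod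
      (ContinuousLinearMap.pi fun p : Fin d × Fin d ↦ pr (.inr s(p.1, p.2))))
  · exact (hcov _ _).trans (covariance_apply_apply hη hη0 hη1 i i')
  · exact (hcov _ _).trans (covariance_mul_mul hη j k j' k')
  · exact (hcov _ _).trans (covariance_apply_mul hη hη0 i j k)

lemma memLp_momentVector (hη : ∀ i, MemLp (fun ω ↦ η ω i) 4 P) (a : Fin d ⊕ Fin d × Fin d) :
    MemLp (fun ω ↦ momentVector (η ω) a) 2 P := by
  rcases a with i | p
  · exact (hη i).mono_exponent (by norm_num)
  · exact (memLp_two_mul_of_memLp_four hη p.1 p.2).sub (memLp_const _)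

lemma integral_momentVector (hη : ∀ i, MemLp (fun ω ↦ η ω i) 4 P)
    (hη0 : ∀ i, ∫ ω, η ω i ∂P = 0)
    (hη1 : ∀ i j, ∫ ω, η ω i * η ω j ∂P = (1 : Matrix (Fin d) (Fin d) ℝ) i j)
    (a : Fin d ⊕ Fin d × Fin d) : ∫ ω, momentVector (η ω) a ∂P = 0 := by
  rcases a with i | p
  · exact hη0 i
  · simp only [momentVector, Sum.elim_inr]
    rw [integral_sub ((memLp_two_mul_of_memLp_four hη p.1 p.2).integrable (by norm_num))
      (integrable_const _), hη1]
    simp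

/-- The covariance hypothesis of the central limit theorem; the centering constants in
`momentVector` do not affect covariances. -/
lemma IsGaussianLimitPair.covariance_eq (hG : IsGaussianLimitPair η P H Z Q)
    (hη : ∀ i, MemLp (fun ω ↦ η ω i) 4 P) (hη0 : ∀ i, ∫ ω, η ω i ∂P = 0)
    (hη1 : ∀ i j, ∫ ω, η ω i * η ω j ∂P = (1 : Matrix (Fin d) (Fin d) ℝ) i j)
    (a b : Fin d ⊕ Fin d × Fin d) :
    cov[fun ω ↦ Sum.elim (H ω) (fun p ↦ Z ω p.1 p.2) a,
      fun ω ↦ Sum.elim (H ω) (fun p ↦ Z ω p.1 p.2) b; Q] =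
    cov[fun ω ↦ momentVector (η ω) a, fun ω ↦ momentVector (η ω) b; P] := by
  have hint (p : Fin d × Fin d) : Integrable (fun ω ↦ η ω p.1 * η ω p.2) P :=
    (memLp_two_mul_of_memLp_four hη p.1 p.2).integrable (by norm_num)
  rcases a with i | p <;> rcases b with i' | q <;>
    simp only [momentVector, Sum.elim_inl, Sum.elim_inr]
  · rw [hG.cov_H, covariance_apply_apply hη hη0 hη1]
  · rw [hG.cov_HZ, covariance_sub_const_right (hint q), covariance_apply_mul hη hη0]
  · rw [covariance_comm, hG.cov_HZ, covariance_sub_const_left (hint p), covariance_comm,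
      covariance_apply_mul hη hη0]
  · rw [hG.cov_Z, covariance_sub_const_left (hint p), covariance_sub_const_right (hint q),
      covariance_mul_mul hη]

end Moments

/-! ### Almost sure convergence and the exact formula for `n` times the divergence. -/

section Limit

variable {d : ℕ} {Ω : Type*} [MeasurableSpace Ω] {P : Measure Ω}

/-- The strong law of large numbers for a centered sequence of vectors. -/
lemma ae_tendsto_inv_sqrt_smul_sum {ι : Type*} [Finite ι] {V : ℕ → Ω → ι → ℝ}
    (hindep : iIndepFun V P) (hident : ∀ k, IdentDistrib (V k) (V 0) P P)
    (hV : ∀ i, Integrable (fun ω ↦ V 0 ω i) P) (hV0 : ∀ i, ∫ ω, V 0 ω i ∂P = 0) :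
    ∀ᵐ ω ∂P, ∀ i, Tendsto
      (fun n : ℕ ↦ (√n)⁻¹ * ((√n)⁻¹ • ∑ k ∈ Finset.range n, V k ω) i) atTop (𝓝 0) := by
  refine ae_all_iff.2 fun i ↦ ?_
  have hi : Measurable fun v : ι → ℝ ↦ v i := measurable_pi_apply i
  filter_upwards [strong_law_ae_real (fun k ω ↦ V k ω i) (hV i)
    (fun k l hkl ↦ (hindep.indepFun hkl).comp hi hi) fun k ↦ (hident k).comp hi] with ω hω
  rw [hV0] at hω
  refine hω.congr fun n ↦ ?_
  simp only [Pi.smul_apply, Finset.sum_apply, smul_eq_mul]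
  rw [← mul_assoc, ← mul_inv, Real.mul_self_sqrt n.cast_nonneg, div_eq_inv_mul]

/-- `ε (W - ε h hᵀ) = εW - (εh)(εh)ᵀ` depends on `ε u` alone, so the strong law suffices and `u`
need not stay bounded. -/
lemma tendsto_trace_mul_self_smul_correctedMatrix {ε : ℕ → ℝ}
    {u : ℕ → Fin d ⊕ Fin d × Fin d → ℝ} (h : ∀ a, Tendsto (fun n ↦ ε n * u n a) atTop (𝓝 0)) :
    Tendsto (fun n ↦ ((ε n • correctedMatrix (ε n) (u n)) *
      (ε n • correctedMatrix (ε n) (u n))).trace) atTop (𝓝 0) := by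
  have hB : Tendsto (fun n ↦ ε n • correctedMatrix (ε n) (u n)) atTop (𝓝 0) := by
    refine tendsto_pi_nhds.2 fun j ↦ tendsto_pi_nhds.2 fun k ↦ ?_
    have := (h (.inr (j, k))).sub ((h (.inl j)).mul (h (.inl k)))
    simp only [mul_zero, sub_zero] at this
    refine this.congr fun n ↦ ?_
    simp only [correctedMatrix, Matrix.smul_apply, Matrix.of_apply, smul_eq_mul]
    ring
  have hc : Continuous fun B : Matrix (Fin d) (Fin d) ℝ ↦ (B * B).trace := by fun_prop
  have h0 := hc.tendsto 0
  rw [Matrix.mul_zero, Matrix.trace_zero] at h0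
  exact h0.comp hB

/-- The divergence multiplied by `n`, as a function of the normalized sums. -/
lemma mul_momentDivergence_sample_eq (n : ℕ) {m : Fin d → ℝ} {S : Matrix (Fin d) (Fin d) ℝ}
    (hS : S.PosDef) (x : ℕ → Fin d → ℝ) {u : Fin d ⊕ Fin d × Fin d → ℝ}
    (hu : u = (√n)⁻¹ • ∑ t ∈ Finset.range n, momentVector (isotropic m S (x t))) :
    (n : ℝ) * momentDivergence (sampleMean n x) (sampleCov n x) m S =
      (fun i ↦ u (.inl i)) ⬝ᵥ (fun i ↦ u (.inl i))
      + 1 / 2 * (correctedMatrix (√n)⁻¹ u * correctedMatrix (√n)⁻¹ u).trace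
      + (correctedMatrix (√n)⁻¹ u * correctedMatrix (√n)⁻¹ u).trace *
        logDetError ((√n)⁻¹ • correctedMatrix (√n)⁻¹ u) := by
  -- For `n = 0` the sum is empty and `(√0)⁻¹ = 0`, so both sides vanish.
  rcases eq_or_ne n 0 with rfl | hn
  · have hu0 : u = 0 := by simp [hu]
    have h0 : correctedMatrix (d := d) 0 0 = 0 := by ext j k; simp [correctedMatrix]
    simp [hu0, h0, dotProduct]
  have hε : (n : ℝ) * ((√(n : ℝ))⁻¹ * (√(n : ℝ))⁻¹) = 1 := by
    rw [← mul_inv, Real.mul_self_sqrt n.cast_nonneg, mul_inv_cancel₀ (by exact_mod_cast hn)]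
  set y := fun t ↦ isotropic m S (x t) with hy
  have hB : sampleCov n y - 1 = (√n)⁻¹ • correctedMatrix (√n)⁻¹ u := by
    rw [hu]; exact sampleCov_sub_one_eq_smul hn y
  have hherm : ((√n)⁻¹ • correctedMatrix (√n)⁻¹ u).IsHermitian := by
    rw [hu]; exact isHermitian_smul_correctedMatrix_sum n _ y
  have hmean : sampleMean n y = (√n)⁻¹ • fun i ↦ u (.inl i) := by
    ext i
    rw [hu]
    exact sampleMean_eq_smul n y i
  have hdet : sampleCov n y = 1 + (√n)⁻¹ • correctedMatrix (√n)⁻¹ u := by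
    rw [← hB, add_sub_cancel]
  rw [momentDivergence_sample_eq hn hS, ← hy, hB, hdet, trace_sub_log_det_one_add_eq hherm, hmean]
  simp only [smul_dotProduct, dotProduct_smul, Matrix.smul_mul, Matrix.mul_smul, Matrix.trace_smul,
    smul_eq_mul]
  linear_combination ((fun i ↦ u (.inl i)) ⬝ᵥ (fun i ↦ u (.inl i))
    + 1 / 2 * (correctedMatrix (√n)⁻¹ u * correctedMatrix (√n)⁻¹ u).trace
    + (correctedMatrix (√n)⁻¹ u * correctedMatrix (√n)⁻¹ u).trace *
        logDetError ((√n)⁻¹ • correctedMatrix (√n)⁻¹ u)) * hε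

lemma tendsto_inv_sqrt_natCast : Tendsto (fun n : ℕ ↦ (√(n : ℝ))⁻¹) atTop (𝓝 0) :=
  tendsto_inv_atTop_zero.comp (Real.tendsto_sqrt_atTop.comp tendsto_natCast_atTop_atTop)

/-- If a statement holds whenever `f n < 1`, where `f n → 0` almost surely, then its probability
tends to one. -/
lemma tendsto_measure_one_of_ae_tendsto_zero [IsProbabilityMeasure P] {f : ℕ → Ω → ℝ}
    {p : ℕ → Ω → Prop}
    (hf : ∀ n, AEMeasurable (f n) P) (h : ∀ᵐ ω ∂P, Tendsto (fun n ↦ f n ω) atTop (𝓝 0))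
    (hp : ∀ᶠ n in atTop, ∀ ω, f n ω < 1 → p n ω) :
    Tendsto (fun n ↦ P {ω | p n ω}) atTop (𝓝 1) := by
  have hbad : Tendsto (fun n ↦ P {ω | 1 ≤ ‖f n ω - 0‖}) atTop (𝓝 0) :=
    tendstoInMeasure_iff_norm.1
      (tendstoInMeasure_of_tendsto_ae (fun n ↦ (hf n).aestronglyMeasurable) h) 1 one_pos
  have hlow : Tendsto (fun n ↦ 1 - P {ω | 1 ≤ ‖f n ω - 0‖}) atTop (𝓝 1) := by
    simpa using ENNReal.Tendsto.sub tendsto_const_nhds hbad (.inl ENNReal.one_ne_top)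
  refine tendsto_of_tendsto_of_tendsto_of_le_of_le' hlow tendsto_const_nhds ?_
    (.of_forall fun n ↦ prob_le_one)
  filter_upwards [hp] with n hn
  rw [tsub_le_iff_right, ← measure_univ (μ := P)]
  -- A union bound over the whole space avoids measurability of the event `p n`.
  refine (measure_mono fun ω _ ↦ ?_).trans (measure_union_le _ _)
  rcases lt_or_ge (f n ω) 1 with hlt | hge
  · exact .inl (hn ω hlt)
  · refine .inr ?_
    simpa using hge.trans (le_abs_self _)

end Limit

/-! ### The limit theorem. -/

theorem theorem1 {d : ℕ}
    -- the random vector `ξ`, with mean `m`, covariance matrix `S` and finite fourth moment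
    {Ω₀ : Type*} [MeasurableSpace Ω₀] (P₀ : Measure Ω₀) [IsProbabilityMeasure P₀]
    (ξ : Ω₀ → Fin d → ℝ) (m : Fin d → ℝ) (S : Matrix (Fin d) (Fin d) ℝ)
    (hξ : MemLp ξ 4 P₀)
    (hm : ∀ i, ∫ ω, ξ ω i ∂P₀ = m i)
    (hcov : ∀ i j, cov[fun ω ↦ ξ ω i, fun ω ↦ ξ ω j; P₀] = S i j)
    (hS : S.PosDef)
    -- independent samples, each distributed as `ξ`
    {Ω : Type*} [MeasurableSpace Ω] (P : Measure Ω) [IsProbabilityMeasure P]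
    (X : ℕ → Ω → Fin d → ℝ)
    (hindep : iIndepFun X P)
    (hident : ∀ t, IdentDistrib (X t) ξ P P₀) :
    -- the Gaussian pair `(H, Z)` exists
    (∃ (Ω' : Type) (_ : MeasurableSpace Ω') (Q : Measure Ω') (_ : IsProbabilityMeasure Q)
      (H : Ω' → Fin d → ℝ) (Z : Ω' → Matrix (Fin d) (Fin d) ℝ),
      IsGaussianLimitPair (fun ω ↦ isotropic m S (ξ ω)) P₀ H Z Q) ∧
    -- the sample covariance matrix is positive definite with probability tending to one
    Tendsto (fun n : ℕ ↦ P {ω | (sampleCov n (fun t ↦ X t ω)).PosDef}) atTop (𝓝 1) ∧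
    -- convergence in distribution, for every realization of the pair
    ∀ {Ω' : Type*} [MeasurableSpace Ω'] (Q : Measure Ω') [IsProbabilityMeasure Q]
      (H : Ω' → Fin d → ℝ) (Z : Ω' → Matrix (Fin d) (Fin d) ℝ),
      IsGaussianLimitPair (fun ω ↦ isotropic m S (ξ ω)) P₀ H Z Q →
      TendstoInDistribution
        (fun (n : ℕ) (ω : Ω) ↦ (n : ℝ) *
          momentDivergence (sampleMean n (fun t ↦ X t ω)) (sampleCov n (fun t ↦ X t ω)) m S)
        atTop
        (fun ω ↦ H ω ⬝ᵥ H ω + 1 / 2 * (Z ω * Z ω).trace)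
        (fun _ ↦ P) Q := by
  have hξ2 : MemLp ξ 2 P₀ := hξ.mono_exponent (by norm_num)
  have hη := hξ.isotropic_apply m S
  have hη0 := integral_isotropic_apply S hξ2 hm
  have hη1 := integral_isotropic_mul_isotropic hξ2 hm hcov hS
  have hφ : Measurable fun x ↦ momentVector (isotropic m S x) :=
    measurable_momentVector.comp (measurable_isotropic m S)
  set V : ℕ → Ω → Fin d ⊕ Fin d × Fin d → ℝ :=
    fun t ω ↦ momentVector (isotropic m S (X t ω)) with hVdef
  have hVξ t : IdentDistrib (V t) (fun ω ↦ momentVector (isotropic m S (ξ ω))) P P₀ :=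
    (hident t).comp hφ
  have hVindep : iIndepFun V P := hindep.comp (fun _ ↦ _) fun _ ↦ hφ
  have hVident t : IdentDistrib (V t) (V 0) P P := (hVξ t).trans (hVξ 0).symm
  have hVa a : IdentDistrib (fun ω ↦ V 0 ω a)
      (fun ω ↦ momentVector (isotropic m S (ξ ω)) a) P P₀ :=
    (hVξ 0).comp (measurable_pi_apply a)
  have hVL a : MemLp (fun ω ↦ V 0 ω a) 2 P := (hVa a).memLp_iff.2 (memLp_momentVector hη a)
  have hV0 a : ∫ ω, V 0 ω a ∂P = 0 :=
    (hVa a).integral_eq.trans (integral_momentVector hη hη0 hη1 a)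
  set U : ℕ → Ω → Fin d ⊕ Fin d × Fin d → ℝ :=
    fun n ω ↦ (√n)⁻¹ • ∑ t ∈ Finset.range n, V t ω with hUdef
  have hUm n : AEMeasurable (U n) P :=
    AEMeasurable.fun_const_smul
      (Finset.aemeasurable_fun_sum _ fun t _ ↦ (hVident t).aemeasurable_fst) _
  have hslln := ae_tendsto_inv_sqrt_smul_sum hVindep hVident
    (fun a ↦ (hVL a).integrable (by norm_num)) hV0
  have hBherm (n : ℕ) ω : ((√n)⁻¹ • correctedMatrix (√n)⁻¹ (U n ω)).IsHermitian :=
    isHermitian_smul_correctedMatrix_sum n _ _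
  have htr : ∀ᵐ ω ∂P, Tendsto (fun n : ℕ ↦ (((√n)⁻¹ • correctedMatrix (√n)⁻¹ (U n ω)) *
      ((√n)⁻¹ • correctedMatrix (√n)⁻¹ (U n ω))).trace) atTop (𝓝 0) := by
    filter_upwards [hslln] with ω hω using tendsto_trace_mul_self_smul_correctedMatrix hω
  refine ⟨exists_isGaussianLimitPair hη hη0 hη1, ?_, ?_⟩
  · refine tendsto_measure_one_of_ae_tendsto_zero
      (fun n ↦ (measurable_trace_mul_self_correctedMatrix _).comp_aemeasurable (hUm n)) htr ?_
    filter_upwards [eventually_ne_atTop 0] with n hn ω hω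
    refine posDef_sampleCov_of_isotropic (m := m) hn hS ?_
    rw [← add_sub_cancel 1 (sampleCov n _), sampleCov_sub_one_eq_smul hn]
    exact (hBherm n ω).posDef_one_add hω
  · intro Ω' _ Q _ H Z hG
    have hpr (a : Fin d ⊕ Fin d × Fin d) : Measurable fun v : Fin d ⊕ Fin d × Fin d → ℝ ↦ v a :=
      measurable_pi_apply a
    have hcovV a b : cov[fun ω ↦ V 0 ω a, fun ω ↦ V 0 ω b; P] =
        cov[fun ω ↦ momentVector (isotropic m S (ξ ω)) a,
          fun ω ↦ momentVector (isotropic m S (ξ ω)) b; P₀] := by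
      rw [← covariance_map_fun (X := fun v ↦ v a) (Y := fun v ↦ v b)
          (hpr a).aestronglyMeasurable (hpr b).aestronglyMeasurable (hVξ 0).aemeasurable_fst,
        ← covariance_map_fun (X := fun v ↦ v a) (Y := fun v ↦ v b)
          (hpr a).aestronglyMeasurable (hpr b).aestronglyMeasurable (hVξ 0).aemeasurable_snd,
        (hVξ 0).map_eq]
    have hclt : TendstoInDistribution U atTop
        (fun ω ↦ Sum.elim (H ω) (fun p : Fin d × Fin d ↦ Z ω p.1 p.2)) (fun _ ↦ P) Q := by
      refine tendstoInDistribution_inv_sqrt_smul_sum hVindep hVident hVL hV0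
        hG.hasGaussianLaw_sumElim ?_ fun a b ↦ ?_
      · rintro (i | p)
        · exact hG.mean_H i
        · exact hG.mean_Z p.1 p.2
      · rw [hcovV, hG.covariance_eq hη hη0 hη1]
    -- The two vanishing quantities `n^{-1/2}` and `r(B)`; tending to a constant in probability,
    -- they join `U` by Slutsky's theorem.
    let R : ℕ → Ω → ℝ × ℝ :=
      fun n ω ↦ ((√n)⁻¹, logDetError ((√n)⁻¹ • correctedMatrix (√n)⁻¹ (U n ω)))
    have hRm n : AEMeasurable (R n) P := aemeasurable_const.prodMk
      ((measurable_logDetError_correctedMatrix _).comp_aemeasurable (hUm n))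
    have hR : TendstoInMeasure P R atTop fun _ ↦ (0, 0) := by
      refine tendstoInMeasure_of_tendsto_ae (fun n ↦ (hRm n).aestronglyMeasurable) ?_
      filter_upwards [htr] with ω hω
      exact tendsto_inv_sqrt_natCast.prodMk_nhds
        (tendsto_logDetError (fun n ↦ hBherm n ω) hω)
    -- The logarithm enters only through the coordinate `q.2.2`, so `g` is a polynomial and
    -- continuous everywhere.
    let g : (Fin d ⊕ Fin d × Fin d → ℝ) × (ℝ × ℝ) → ℝ := fun q ↦
      (fun i ↦ q.1 (.inl i)) ⬝ᵥ (fun i ↦ q.1 (.inl i))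
      + 1 / 2 * (correctedMatrix q.2.1 q.1 * correctedMatrix q.2.1 q.1).trace
      + (correctedMatrix q.2.1 q.1 * correctedMatrix q.2.1 q.1).trace * q.2.2
    have hg : Continuous g := by
      have hA : Continuous fun q : (Fin d ⊕ Fin d × Fin d → ℝ) × (ℝ × ℝ) ↦
          correctedMatrix q.2.1 q.1 :=
        continuous_correctedMatrix.comp (by fun_prop : Continuous fun
          q : (Fin d ⊕ Fin d × Fin d → ℝ) × (ℝ × ℝ) ↦ (q.2.1, q.1))
      have hT := (hA.matrix_mul hA).matrix_trace
      have hD : Continuous fun q : (Fin d ⊕ Fin d × Fin d → ℝ) × (ℝ × ℝ) ↦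
          (fun i : Fin d ↦ q.1 (.inl i)) ⬝ᵥ (fun i ↦ q.1 (.inl i)) := by
        unfold dotProduct; fun_prop
      exact (hD.add (continuous_const.mul hT)).add (hT.mul (by fun_prop))
    refine (hclt.continuous_comp_prodMk_of_tendstoInMeasure_const hg hR hRm).congr
      (fun n ↦ .of_forall fun ω ↦ ?_) (.of_forall fun ω ↦ ?_)
    · exact (mul_momentDivergence_sample_eq n hS (fun t ↦ X t ω) rfl).symm
    -- At `(0, 0)` the correction `h hᵀ` and the error term both drop out.
    · have hZ : correctedMatrix 0 (Sum.elim (H ω) fun p ↦ Z ω p.1 p.2) = Z ω := by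
        ext j k
        simp [correctedMatrix]
      simp [g, hZ]
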